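/- All cardinals are identified with initial ordinals, and $\alpha^*$ denotes the reverse of an order type $\alpha$. A set $Y$ of finite sets is a \emph{sunflower} if there is a set $r$ such that $p\cap q=r$ for all distinct $p,q\in Y$. For $n\in\omega$, an infinite linear order $\mathcal X$ is \emph{$n$-sunflowerable} if for every structure $\mathcal Y=(Y,\le_Y)\cong\mathcal X$ whose underlying set $Y$ consists of sets of size $n$ there is a sunflower $Z\subseteq Y$ with $(Z,\le_Y)\cong\mathcal Y$; it is \emph{sunflowerable} if it is $n$-sunflowerable for every $n\in\omega$. A linear order is \emph{$\kappa$-dense} if it has at least two elements and, for all elements $a<b$, exactly $\kappa$ elements $c$ satisfy $a<c<b$; a linear order is \emph{$\kappa$-scattered} if no subset of it is $\kappa$-dense in the induced order. \textbf{Theorem.} Let $\kappa$ be an infinite cardinal and let $\mathcal X=(X,\le)$ be a $\kappa$-scattered linear order of size $\kappa$. Consider the conditions (a) $\mathcal X$ is $2$-sunflowerable; (b) $\mathcal X$ is sunflowerable; (c) $\mathcal X$ has order type $\kappa$ or $\kappa^*$. If $\kappa$ is regular, then (a), (b) and (c) are equivalent. For every infinite $\kappa$, regular or singular, (a) and (b)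 are equivalent and imply (c). -/

import Mathlib

open Cardinal

universe u

/-- A family of finite sets is a sunflower if all intersections of two distinct members are the
same set. -/
def IsSunflower {S : Type u} (Y : Set (Finset S)) : Prop :=
  ∃ r : Set S, ∀ p ∈ Y, ∀ q ∈ Y, p ≠ q → (p : Set S) ∩ (q : Set S) = r

/-- `(Y, R)` contains a structured sunflower: some substructure `(Z, R)` of `(Y, R)` is isomorphic
to `(Y, R)` and its underlying set is a sunflower. -/
def ContainsStructuredSunflower {S : Type u} (Y : Set (Finset S)) (R : Y → Y → Prop) : Prop :=
  ∃ Z : Set Y, Nonempty (Subrel R (· ∈ Z) ≃r R) ∧ IsSunflower (Subtype.val '' Z)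

/-- The ordered set `X` is `n`-sunflowerable: every isomorphic copy `(Y, R)` of `(X, ≤)` whose
elements are `n`-element sets contains a structured sunflower. The relation `R` on `Y` is arbitrary
and is not related to inclusion of sets. The union of such a `Y` has at most `max ℵ₀ #X` elements,
so ground types `S` in the universe of `X` account for all copies. -/
def IsNSunflowerable (n : ℕ) (X : Type u) [LinearOrder X] : Prop :=
  ∀ (S : Type u) (Y : Set (Finset S)) (R : Y → Y → Prop),
    Nonempty (R ≃r ((· ≤ ·) : X → X → Prop)) → (∀ y ∈ Y, y.card = n) →
      ContainsStructuredSunflower Y R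

/-- `X` is sunflowerable if it is `n`-sunflowerable for every natural number `n`. -/
def IsSunflowerable (X : Type u) [LinearOrder X] : Prop :=
  ∀ n : ℕ, IsNSunflowerable n X

/-- A linear order is `κ`-dense if it has at least two points and exactly `κ` points lie strictly
between any two of its points. -/
def IsKDense (κ : Cardinal.{u}) (X : Type u) [LinearOrder X] : Prop :=
  Nontrivial X ∧ ∀ a b : X, a < b → #{c : X // a < c ∧ c < b} = κ

/-- A linear order is `κ`-scattered if no subset of it is `κ`-dense in the induced order. -/
def IsKScattered (κ : Cardinal.{u}) (X : Type u) [LinearOrder X] : Prop :=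
  ¬ ∃ Y : Set X, IsKDense κ Y

/-- `X` has order type `κ` (the initial ordinal of cardinality `κ`) or its reverse `κ*`. -/
def HasOrderTypeCardOrDual (κ : Cardinal.{u}) (X : Type u) [LinearOrder X] : Prop :=
  Nonempty (X ≃o κ.ord.ToType) ∨ Nonempty (X ≃o (κ.ord.ToType)ᵒᵈ)

/-! Both (a) and (b) amount to `HasHomogeneousCopies`. Coding `f` by the pairs {x, f x} gives one
direction. For the other, make the n coordinate functions constant or injective one at a time;
collisions between injective coordinates form a graph of bounded degree, and a copy inside one
colour class is a sunflower.

For (c), identify points with no copy of `X` between them. On some copy the quotient map is constant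
or injective; injectivity would make the class representatives κ-dense (`not_hasCopyIn_uIcc`). So no
bounded interval contains a copy, and a copy in a final segment maps strictly monotonically into κ
(`nonempty_orderIso_of_hasCopyIn_Ici`); initial segments are dual. Regularity serves only in the
converse, through the pigeonhole principle. -/

/-- Every function on `X` is constant or injective on some subset of `X` that is isomorphic
to `X`. -/
def HasHomogeneousCopies (X : Type u) [LinearOrder X] : Prop :=
  ∀ (T : Type u) (f : X → T), ∃ e : X → X, StrictMono e ∧
    ((∀ x y, f (e x) = f (e y)) ∨ Function.Injective (f ∘ e))

/-- Some subset of `A` is isomorphic to `X`. -/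
def HasCopyIn {X : Type u} [LinearOrder X] (A : Set X) : Prop :=
  ∃ e : X → X, StrictMono e ∧ ∀ x, e x ∈ A

/-! ### Sunflowers and homogeneous copies -/

section Sunflowers

variable {X : Type u} [LinearOrder X]

theorem HasHomogeneousCopies.of_isNSunflowerable_two (h : IsNSunflowerable 2 X) :
    HasHomogeneousCopies X := by
  classical
  intro T f
  -- The tag `Sum.inl x` keeps the sets distinct, so two of them can share only a value of `f`.
  let p : X → Finset (X ⊕ T) := fun x => {Sum.inl x, Sum.inr (f x)}
  have hp : Function.Injective p := by
    intro x y hxy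
    have : Sum.inl x ∈ p y := by rw [← hxy]; simp [p]
    simpa [p] using this
  let ψ : X ≃ Set.range p := Equiv.ofInjective p hp
  let R : Set.range p → Set.range p → Prop := fun a b => ψ.symm a ≤ ψ.symm b
  let φ : R ≃r ((· ≤ ·) : X → X → Prop) := ⟨ψ.symm, Iff.rfl⟩
  obtain ⟨Z, ⟨θ⟩, r, hr⟩ := h (X ⊕ T) (Set.range p) R ⟨φ⟩ (by
    rintro _ ⟨x, rfl⟩
    exact Finset.card_pair (by simp))
  let η := φ.symm.trans θ.symm
  let e : X → X := fun x => ψ.symm (η x).1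
  have he : StrictMono e := by
    have h1 : ∀ x y, e x ≤ e y ↔ x ≤ y := fun x y => η.map_rel_iff
    exact strictMono_of_le_iff_le fun x y => (h1 x y).symm
  have hmem : ∀ x, p (e x) ∈ Subtype.val '' Z := by
    intro x
    have : p (e x) = ((η x).1 : Finset (X ⊕ T)) :=
      congrArg Subtype.val (ψ.apply_symm_apply (η x).1)
    rw [this]
    exact ⟨_, (η x).2, rfl⟩
  have hr' : ∀ x y, x ≠ y → (p (e x) : Set (X ⊕ T)) ∩ p (e y) = r := fun x y hxy =>
    hr _ (hmem x) _ (hmem y) fun h => hxy (he.injective (hp h))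
  refine ⟨e, he, ?_⟩
  by_cases hinj : Function.Injective (f ∘ e)
  · exact Or.inr hinj
  left
  simp only [Function.Injective, not_forall, Function.comp_apply] at hinj
  obtain ⟨a, b, hab, hne⟩ := hinj
  have hc : Sum.inr (f (e a)) ∈ r := by
    rw [← hr' a b hne]
    simp [p, hab]
  have key : ∀ z, f (e z) = f (e a) := by
    intro z
    by_cases hz : z = a
    · rw [hz]
    · rw [← hr' z a hz] at hc
      have := hc.1
      simp only [p, Finset.coe_insert, Finset.coe_singleton, Set.mem_insert_iff,
        Set.mem_singleton_iff, reduceCtorEq, Sum.inr.injEq, false_or] at this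
      exact this.symm
  exact fun x y => (key x).trans (key y).symm

/-- A relation all of whose out-neighbourhoods have at most `d` elements, and which is symmetric and
irreflexive, has a proper colouring with `d + 1` colours. -/
theorem exists_coloring_of_card_le {V : Type*} (G : V → V → Prop) (hsymm : ∀ x y, G x y → G y x)
    (hirr : ∀ x, ¬ G x x) (d : ℕ) (N : V → Finset V) (hN : ∀ x, (N x).card ≤ d)
    (hG : ∀ x y, G x y → y ∈ N x) :
    ∃ c : V → Fin (d + 1), ∀ x y, G x y → c x ≠ c y := by
  classical
  have hex : ∀ (x : V) (g : V → Fin (d + 1)), ∃ k, k ∉ (N x).image g := by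
    intro x g
    have : ((N x).image g).card < (Finset.univ : Finset (Fin (d + 1))).card := by
      rw [Finset.card_univ, Fintype.card_fin]
      exact Nat.lt_succ_of_le (Finset.card_image_le.trans (hN x))
    obtain ⟨k, -, hk⟩ := Finset.exists_mem_notMem_of_card_lt_card this
    exact ⟨k, hk⟩
  have wf : WellFounded (WellOrderingRel : V → V → Prop) := IsWellFounded.wf
  -- Greedy colouring along a well-order; the default 0 for later vertices still leaves at most `d`
  -- forbidden colours.
  let F : ∀ x : V, (∀ y, WellOrderingRel y x → Fin (d + 1)) → Fin (d + 1) := fun x c =>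
    (hex x fun y => if h : WellOrderingRel y x then c y h else 0).choose
  let c : V → Fin (d + 1) := wf.fix F
  have hc : ∀ x y, WellOrderingRel y x → G x y → c x ≠ c y := by
    intro x y hyx hxy heq
    have h1 : c x = F x fun y _ => c y := wf.fix_eq F x
    have h2 := (hex x fun y => if h : WellOrderingRel y x then c y else 0).choose_spec
    apply h2
    refine Finset.mem_image.2 ⟨y, hG x y hxy, ?_⟩
    simp only [hyx, dite_true]
    exact heq.symm.trans h1
  refine ⟨c, fun x y hxy => ?_⟩
  rcases trichotomous_of (WellOrderingRel : V → V → Prop) x y with h | h | h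
  · exact (hc y x h (hsymm x y hxy)).symm
  · exact absurd (h ▸ hxy) (hirr x)
  · exact hc x y h hxy

theorem HasHomogeneousCopies.finset (hX : HasHomogeneousCopies X) {ι T : Type u}
    (a : ι → X → T) (s : Finset ι) :
    ∃ e : X → X, StrictMono e ∧
      ∀ i ∈ s, (∀ x y, a i (e x) = a i (e y)) ∨ Function.Injective (a i ∘ e) := by
  classical
  induction s using Finset.induction_on with
  | empty => exact ⟨id, strictMono_id, by simp⟩
  | insert i s _ ih =>
    obtain ⟨e, he, hs⟩ := ih
    obtain ⟨g, hg, hi⟩ := hX T (a i ∘ e)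
    refine ⟨e ∘ g, he.comp hg, fun j hj => ?_⟩
    rcases Finset.mem_insert.1 hj with rfl | hj
    · exact hi
    · exact (hs j hj).imp (fun h x y => h _ _) fun h => h.comp hg.injective

theorem HasHomogeneousCopies.exists_constant_of_finite [Infinite X] (hX : HasHomogeneousCopies X)
    {T : Type u} [Finite T] (f : X → T) :
    ∃ e : X → X, StrictMono e ∧ ∀ x y, f (e x) = f (e y) := by
  obtain ⟨e, he, h | h⟩ := hX T f
  · exact ⟨e, he, h⟩
  · exact absurd h (not_injective_infinite_finite _)

theorem HasHomogeneousCopies.isNSunflowerable [Infinite X] (hX : HasHomogeneousCopies X) (n : ℕ) :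
    IsNSunflowerable n X := by
  classical
  rintro S Y R ⟨φ⟩ hY
  let p : X → Finset S := fun x => (φ.symm x).1
  have hcard : ∀ x, (p x).card = n := fun x => hY _ (φ.symm x).2
  let a : ULift.{u} (Fin n) → X → S := fun i x => ((p x).equivFinOfCardEq (hcard x)).symm i.down
  have ha : ∀ x s, s ∈ p x ↔ ∃ i, a i x = s := by
    intro x s
    constructor
    · intro hs
      exact ⟨⟨(p x).equivFinOfCardEq (hcard x) ⟨s, hs⟩⟩, by simp [a]⟩
    · rintro ⟨i, rfl⟩
      exact (((p x).equivFinOfCardEq (hcard x)).symm i.down).2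
  obtain ⟨e, he, hae⟩ := hX.finset a Finset.univ
  let G : X → X → Prop := fun x y => x ≠ y ∧ ∃ i j, Function.Injective (a i ∘ e) ∧
    Function.Injective (a j ∘ e) ∧ a i (e x) = a j (e y)
  -- For fixed `(i, j)`, injectivity of `a j ∘ e` leaves at most one neighbour `y`; junk values of
  -- `invFun` only enlarge the set.
  let N : X → Finset X := fun x =>
    (Finset.univ : Finset (ULift.{u} (Fin n) × ULift.{u} (Fin n))).image fun ij =>
      Function.invFun (a ij.2 ∘ e) (a ij.1 (e x))
  obtain ⟨c, hc⟩ := exists_coloring_of_card_le G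
    (fun x y ⟨hxy, i, j, hi, hj, h⟩ => ⟨hxy.symm, j, i, hj, hi, h.symm⟩)
    (fun x h => h.1 rfl) _ N (fun x => Finset.card_image_le) (by
      rintro x y ⟨-, i, j, -, hj, h⟩
      refine Finset.mem_image.2 ⟨(i, j), Finset.mem_univ _, ?_⟩
      simp only [h]
      exact Function.leftInverse_invFun hj y)
  obtain ⟨g, hg, hcg⟩ := hX.exists_constant_of_finite fun x => ULift.up.{u} (c x)
  let η : X → Y := fun x => φ.symm (e (g x))
  have hη : ∀ x y, R (η x) (η y) ↔ x ≤ y := fun x y =>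
    φ.symm.map_rel_iff.trans (he.comp hg).le_iff_le
  have hηinj : Function.Injective η := φ.symm.injective.comp (he.comp hg).injective
  let θ : ((· ≤ ·) : X → X → Prop) ≃r Subrel R (· ∈ Set.range η) :=
    ⟨Equiv.ofInjective η hηinj, fun {x y} => hη x y⟩
  refine ⟨Set.range η, ⟨θ.symm.trans φ.symm⟩,
    {s | ∃ i, (∀ x y, a i (e x) = a i (e y)) ∧ ∃ x, a i (e x) = s}, ?_⟩
  rintro _ ⟨_, ⟨x, rfl⟩, rfl⟩ _ ⟨_, ⟨y, rfl⟩, rfl⟩ hxy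
  have hne : g x ≠ g y := fun h => hxy (by simp only [η, h])
  ext s
  constructor
  · rintro ⟨hx, hy⟩
    obtain ⟨i, hi⟩ := (ha _ _).1 hx
    obtain ⟨j, hj⟩ := (ha _ _).1 hy
    rcases hae i (Finset.mem_univ _) with h1 | h1
    · exact ⟨i, h1, _, hi⟩
    rcases hae j (Finset.mem_univ _) with h2 | h2
    · exact ⟨j, h2, _, hj⟩
    exact absurd (ULift.up_injective (hcg x y)) (hc _ _ ⟨hne, i, j, h1, h2, hi.trans hj.symm⟩)
  · rintro ⟨i, hi, z, rfl⟩
    exact ⟨(ha _ _).2 ⟨i, hi _ _⟩, (ha _ _).2 ⟨i, hi _ _⟩⟩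

end Sunflowers

/-! ### The order types κ and κ* for regular κ -/

section OrderTypes

theorem nonempty_orderIso_ord_toType_of_strictMono {κ : Cardinal.{u}} {A : Type u} [LinearOrder A]
    (hA : #A = κ) (f : A → κ.ord.ToType) (hf : StrictMono f) :
    Nonempty (A ≃o κ.ord.ToType) := by
  have hwf : WellFoundedLT A := hf.wellFoundedLT
  have h1 : Ordinal.type ((· < ·) : A → A → Prop) ≤ κ.ord := by
    rw [← Ordinal.type_toType κ.ord]
    exact Ordinal.type_le_iff'.2 ⟨(OrderEmbedding.ofStrictMono f hf).ltEmbedding⟩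
  have h2 : κ.ord ≤ Ordinal.type ((· < ·) : A → A → Prop) := by
    rw [← hA]
    exact Cardinal.ord_le_type _
  have h3 := (h1.antisymm h2).trans (Ordinal.type_toType κ.ord).symm
  obtain ⟨θ⟩ := Ordinal.type_eq.1 h3
  exact ⟨OrderIso.ofRelIsoLT θ⟩

variable {X : Type u} [LinearOrder X]

theorem HasHomogeneousCopies.dual (hX : HasHomogeneousCopies X) : HasHomogeneousCopies Xᵒᵈ := by
  intro T f
  obtain ⟨e, he, h⟩ := hX T (f ∘ OrderDual.toDual)
  exact ⟨OrderDual.toDual ∘ e ∘ OrderDual.ofDual, he.dual, h⟩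

/-- Every subset of size κ is a copy. A range of size κ yields a transversal; a smaller one yields a
fibre of size κ, by regularity. -/
theorem HasHomogeneousCopies.of_orderIso_ord_toType {κ : Cardinal.{u}} (hκ : κ.IsRegular)
    (φ : X ≃o κ.ord.ToType) : HasHomogeneousCopies X := by
  intro T f
  have hX : #X = κ := by rw [Cardinal.mk_congr φ.toEquiv, Cardinal.mk_ord_toType]
  have key : ∀ A : Set X, #A = κ → ∃ e : X → X, StrictMono e ∧ ∀ x, e x ∈ A := by
    intro A hA
    obtain ⟨θ⟩ := nonempty_orderIso_ord_toType_of_strictMono hA (fun x : A => φ x)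
      fun x y hxy => φ.strictMono hxy
    exact ⟨fun x => θ.symm (φ x), fun x y hxy => θ.symm.strictMono (φ.strictMono hxy),
      fun x => (θ.symm (φ x)).2⟩
  by_cases hr : #(Set.range f) = κ
  · let g : Set.range f → X := fun t => t.2.choose
    have hg : ∀ t, f (g t) = t := fun t => t.2.choose_spec
    have hginj : Function.Injective g := fun s t h => Subtype.ext (by rw [← hg s, ← hg t, h])
    obtain ⟨e, he, hmem⟩ := key (Set.range g) (by rw [Cardinal.mk_range_eq g hginj, hr])
    refine ⟨e, he, Or.inr fun x y hxy => he.injective ?_⟩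
    obtain ⟨s, hs⟩ := hmem x
    obtain ⟨t, ht⟩ := hmem y
    have hst : s = t := Subtype.ext (by rw [← hg s, ← hg t, hs, ht]; exact hxy)
    rw [← hs, ← ht, hst]
  · have hlt : #(Set.range f) < κ := lt_of_le_of_ne (hX ▸ Cardinal.mk_range_le) hr
    obtain ⟨t, ht⟩ := Cardinal.infinite_pigeonhole (Set.rangeFactorization f)
      (hX ▸ hκ.aleph0_le) (by rw [hX, hκ.cof_ord]; exact hlt)
    obtain ⟨e, he, hmem⟩ := key _ (ht.trans hX)
    have h : ∀ x, f (e x) = t := fun x => congrArg Subtype.val (hmem x)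
    exact ⟨e, he, Or.inl fun x y => (h x).trans (h y).symm⟩

theorem HasHomogeneousCopies.of_hasOrderTypeCardOrDual {κ : Cardinal.{u}} (hκ : κ.IsRegular)
    (h : HasOrderTypeCardOrDual κ X) : HasHomogeneousCopies X := by
  rcases h with ⟨⟨φ⟩⟩ | ⟨⟨φ⟩⟩
  · exact .of_orderIso_ord_toType hκ φ
  · exact (HasHomogeneousCopies.of_orderIso_ord_toType (X := Xᵒᵈ) hκ
      (φ.dual.trans (OrderIso.dualDual _).symm)).dual

end OrderTypes

/-! ### Location of copies and the order type -/

section Copies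

variable {X : Type u} [LinearOrder X]

theorem HasCopyIn.mono {A B : Set X} (h : HasCopyIn A) (hAB : A ⊆ B) : HasCopyIn B :=
  let ⟨e, he, hA⟩ := h
  ⟨e, he, fun x => hAB (hA x)⟩

theorem HasHomogeneousCopies.hasCopyIn_or [Infinite X] (hX : HasHomogeneousCopies X) {A B : Set X}
    (h : HasCopyIn (A ∪ B)) : HasCopyIn A ∨ HasCopyIn B := by
  obtain ⟨e, he, hAB⟩ := h
  obtain ⟨g, hg, hc⟩ := hX.exists_constant_of_finite fun x => ULift.up.{u} (e x ∈ A)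
  by_cases hA : ∃ x, e (g x) ∈ A
  · obtain ⟨x, hx⟩ := hA
    refine Or.inl ⟨e ∘ g, he.comp hg, fun y => ?_⟩
    exact (ULift.up_injective (hc x y)).mp hx
  · push Not at hA
    exact Or.inr ⟨e ∘ g, he.comp hg, fun y => (hAB (g y)).resolve_left (hA y)⟩

/-- The points `x` and `y` are equivalent if no copy of `X` lies between them. -/
def noCopySetoid [Infinite X] (hX : HasHomogeneousCopies X) : Setoid X where
  r x y := ¬ HasCopyIn (Set.uIcc x y)
  iseqv :=
    { refl := by
        rintro x ⟨e, he, h⟩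
        obtain ⟨a, b, hab⟩ := exists_pair_ne X
        have h' : ∀ y, e y = x := fun y => by simpa using h y
        exact hab (he.injective ((h' a).trans (h' b).symm))
      symm := fun {x y} h => by rwa [Set.uIcc_comm]
      trans := fun {x y z} h1 h2 h =>
        (hX.hasCopyIn_or (h.mono Set.uIcc_subset_uIcc_union_uIcc)).elim h1 h2 }

theorem HasHomogeneousCopies.not_hasCopyIn_uIcc [Infinite X] (hX : HasHomogeneousCopies X)
    (hscat : IsKScattered #X X) (x y : X) : ¬ HasCopyIn (Set.uIcc x y) := by
  let s := noCopySetoid hX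
  have hs : ∀ x y, Quotient.mk s x = Quotient.mk s y ↔ ¬ HasCopyIn (Set.uIcc x y) :=
    fun x y => Quotient.eq
  obtain ⟨e, he, h | h⟩ := hX (Quotient s) (Quotient.mk s)
  · rintro ⟨g, hg, hmem⟩
    refine (hs _ _).1 (h x y) ⟨e ∘ g, he.comp hg, fun z => ?_⟩
    exact he.monotone.image_uIcc_subset ⟨g z, hmem z, rfl⟩
  exfalso
  have hne : ∀ x y, x ≠ y → HasCopyIn (Set.uIcc (e x) (e y)) := fun x y hxy =>
    not_not.1 fun hn => hxy (h ((hs _ _).2 hn))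
  have hout : ∀ q : Quotient s, Quotient.mk s q.out = q := Quotient.out_eq
  have hinj : Function.Injective (Quotient.out : Quotient s → X) := Quotient.out_injective
  refine hscat ⟨Set.range (Quotient.out : Quotient s → X), ?_, ?_⟩
  · obtain ⟨a, b, hab⟩ := exists_pair_ne X
    exact ⟨⟨_, ⟨Quotient.mk s (e a), rfl⟩⟩, ⟨_, ⟨Quotient.mk s (e b), rfl⟩⟩,
      fun hc => hab (h (hinj (congrArg Subtype.val hc)))⟩
  rintro ⟨_, a, rfl⟩ ⟨_, b, rfl⟩ hab
  replace hab : a.out < b.out := hab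
  apply le_antisymm
  · exact (Cardinal.mk_subtype_le _).trans (Cardinal.mk_set_le _)
  have hcopy : HasCopyIn (Set.Icc a.out b.out) := by
    rw [← Set.uIcc_of_le hab.le]
    refine not_not.1 fun hn => hab.ne ?_
    rw [← hs, hout, hout] at hn
    rw [hn]
  obtain ⟨k, hk, hkmem⟩ := hcopy
  let z : X → Quotient s := fun x => Quotient.mk s (k (e x))
  have hz : Function.Injective z := by
    intro x y hxy
    by_contra hne'
    obtain ⟨g, hg, hmem⟩ := hne x y hne'
    exact (hs _ _).1 hxy ⟨k ∘ g, hk.comp hg, fun w =>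
      hk.monotone.image_uIcc_subset ⟨g w, hmem w, rfl⟩⟩
  have hconv : ∀ {u v w : X}, v ∈ Set.uIcc u w → Quotient.mk s u = Quotient.mk s w →
      Quotient.mk s u = Quotient.mk s v := fun hv huw => (hs _ _).2 fun hc =>
    (hs _ _).1 huw (hc.mono (Set.uIcc_subset_uIcc_left hv))
  -- If the representative fell outside the interval, an endpoint would lie between it and `k (e
  -- x)`, hence in their convex class.
  have hbetween : ∀ x, z x ≠ a → z x ≠ b → a.out < (z x).out ∧ (z x).out < b.out := by
    intro x hxa hxb
    obtain ⟨h1, h2⟩ := hkmem (e x)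
    have hzx : Quotient.mk s (k (e x)) = Quotient.mk s (z x).out := (hout _).symm
    constructor
    · by_contra! hle
      exact hxa ((hconv (Set.mem_uIcc.2 (Or.inr ⟨hle, h1⟩)) hzx).trans (hout a))
    · by_contra! hle
      exact hxb ((hconv (Set.mem_uIcc.2 (Or.inl ⟨h2, hle⟩)) hzx).trans (hout b))
  -- The classes of the endpoints are represented by the endpoints themselves; dropping them costs
  -- at most two points.
  let E : Set X := z ⁻¹' {a, b}
  have hE : E.Finite := (Set.toFinite {a, b}).preimage hz.injOn
  rw [← Cardinal.mk_compl_of_infinite E (hE.lt_aleph0.trans_le (Cardinal.aleph0_le_mk X))]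
  have hE' : ∀ x : (Eᶜ : Set X), z x ≠ a ∧ z x ≠ b := fun x =>
    ⟨fun hc => x.2 (Or.inl hc), fun hc => x.2 (Or.inr hc)⟩
  refine Cardinal.mk_le_of_injective (f := fun x : (Eᶜ : Set X) =>
    ⟨⟨(z x).out, ⟨z x, rfl⟩⟩, hbetween x (hE' x).1 (hE' x).2⟩) ?_
  intro x y hxy
  exact Subtype.ext (hz (hinj (congrArg (fun c => (c.1.1 : X)) hxy)))

theorem HasHomogeneousCopies.nonempty_orderIso_of_hasCopyIn_Ici (hX : HasHomogeneousCopies X)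
    (hb : ∀ x y : X, ¬ HasCopyIn (Set.uIcc x y)) {x₀ : X} (h : HasCopyIn (Set.Ici x₀)) :
    Nonempty (X ≃o (#X).ord.ToType) := by
  obtain ⟨e, he, hmem⟩ := h
  obtain ⟨ν⟩ : Nonempty ((#X).ord.ToType ≃ X) :=
    Cardinal.eq.1 (Cardinal.mk_ord_toType #X)
  have hbdd : ∀ (f : X → X), StrictMono f → ∀ y, ∃ x, y < e (f x) := by
    intro f hf y
    by_contra! hle
    exact hb x₀ y ⟨e ∘ f, he.comp hf, fun x => Set.mem_uIcc.2 (Or.inl ⟨hmem _, hle x⟩)⟩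
  have hne : ∀ x, {α | e x < ν α}.Nonempty := by
    intro x
    obtain ⟨y, hy⟩ := hbdd id strictMono_id (e x)
    exact ⟨ν.symm (e y), by simpa using hy⟩
  have wf : WellFounded ((· < ·) : (#X).ord.ToType → _ → Prop) := wellFounded_lt
  -- The least index of a point above `e x`. It is monotone, and constancy on a copy would bound
  -- that copy.
  let g : X → (#X).ord.ToType := fun x => wf.min _ (hne x)
  have hg : ∀ x, e x < ν (g x) := fun x => wf.min_mem _ (hne x)
  have hgm : Monotone g := fun x y hxy =>
    not_lt.1 (wf.not_lt_min _ ((he.monotone hxy).trans_lt (hg y)))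
  obtain ⟨f, hf, hc | hi⟩ := hX _ g
  · obtain ⟨x, hx⟩ := hbdd f hf (ν (g (f x₀)))
    have := hg (f x)
    rw [hc x x₀] at this
    exact absurd (hx.trans this) (lt_irrefl _)
  · exact nonempty_orderIso_ord_toType_of_strictMono rfl (g ∘ f)
      ((hgm.comp hf.monotone).strictMono_of_injective hi)

theorem HasHomogeneousCopies.hasOrderTypeCardOrDual [Infinite X] (hX : HasHomogeneousCopies X)
    (hscat : IsKScattered #X X) : HasOrderTypeCardOrDual #X X := by
  have hb := hX.not_hasCopyIn_uIcc hscat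
  let x₀ : X := Classical.arbitrary X
  rcases hX.hasCopyIn_or (A := Set.Ici x₀) (B := Set.Iic x₀)
    ⟨id, strictMono_id, fun x => le_total x₀ x⟩ with h | h
  · exact Or.inl (hX.nonempty_orderIso_of_hasCopyIn_Ici hb h)
  · right
    have hdual : ∀ A : Set X, HasCopyIn (OrderDual.ofDual ⁻¹' A) → HasCopyIn A :=
      fun A ⟨e, he, hA⟩ => ⟨OrderDual.ofDual ∘ e ∘ OrderDual.toDual, he.dual, hA⟩
    obtain ⟨φ⟩ := hX.dual.nonempty_orderIso_of_hasCopyIn_Ici (x₀ := OrderDual.toDual x₀)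
      (fun x y hc => hb (OrderDual.ofDual x) (OrderDual.ofDual y)
        (hdual _ (hc.mono fun z hz => by
          simp only [Set.mem_preimage, Set.mem_uIcc] at hz ⊢
          exact hz.symm.imp And.symm And.symm)))
      (by
        obtain ⟨e, he, hA⟩ := h
        exact ⟨OrderDual.toDual ∘ e ∘ OrderDual.ofDual, he.dual, hA⟩)
    exact ⟨(OrderIso.dualDual X).trans φ.dual⟩

end Copies

theorem mainTheorem3 (κ : Cardinal.{u}) (hκ : ℵ₀ ≤ κ) (X : Type u) [LinearOrder X]
    (hX : #X = κ) (hscat : IsKScattered κ X) :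
    (κ.IsRegular →
      List.TFAE [IsNSunflowerable 2 X, IsSunflowerable X, HasOrderTypeCardOrDual κ X]) ∧
    (IsNSunflowerable 2 X ↔ IsSunflowerable X) ∧
    (IsNSunflowerable 2 X → HasOrderTypeCardOrDual κ X) := by
  subst hX
  have : Infinite X := Cardinal.infinite_iff.2 hκ
  have hab : IsNSunflowerable 2 X ↔ IsSunflowerable X :=
    ⟨fun h n => (HasHomogeneousCopies.of_isNSunflowerable_two h).isNSunflowerable n, fun h => h 2⟩
  have hac : IsNSunflowerable 2 X → HasOrderTypeCardOrDual #X X := fun h =>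
    (HasHomogeneousCopies.of_isNSunflowerable_two h).hasOrderTypeCardOrDual hscat
  refine ⟨fun hreg => ?_, hab, hac⟩
  tfae_have 1 ↔ 2 := hab
  tfae_have 1 → 3 := hac
  tfae_have 3 → 1 := fun h =>
    (HasHomogeneousCopies.of_hasOrderTypeCardOrDual hreg h).isNSunflowerable 2
  tfae_finish
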